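/- **Conventions.** A triangulation $\mathcal T$ of an open set $\omega\subset\mathbb R^3$ is a finite conforming simplicial complex of (non-degenerate, closed) tetrahedra and their faces such that $\omega$ is the interior of the union of the tetrahedra; its maximal mesh size is $\max_{T\in\mathcal T}\operatorname{diam} T$. A bounded, open, connected, non-empty polyhedral set $\omega\subset\mathbb R^3$ with a triangulation $\mathcal T$ is called *discrete convex* if every vertex $z$ of $\mathcal T$ with $z\in\partial\omega$ has a support plane for $\omega$, i.e. there is $v\in\mathbb R^3\setminus\{0\}$ with $(z-x)\cdot v\ge 0$ for all $x\in\omega$. Triangulations $(\mathcal T_n)_{n\in\mathbb N}$ with maximal mesh sizes $h_n$ are *quasi-uniform* if there is $c>0$ such that for all $n$ every tetrahedron $T\in\mathcal T_n$ contains a ball of radius $c\,h_n$. **Corollary (Compactness).** Let $Q\subset\mathbb R^3$ be convex, bounded and open. Let $(\Omega_n)_{n\in\mathbb N}$ be discrete convex domains with quasi-uniform triangulations $(\mathcal T_n)_{n\in\mathbb N}$ whose maximal mesh sizes $h_n$ tend to $0$, and suppose $\Omega_n\subset Q$ for all $n$. Then there exist a convex open set $\Omega\subset Q$ (possibly empty)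 and a subsequence $(\Omega_{n_k})_k$ such that $\chi_{\Omega_{n_k}}\to\chi_\Omega$ in $L^1(Q)$ as $k\to\infty$. -/

import Mathlib

open Set Filter Topology MeasureTheory
open scoped ENNReal RealInnerProductSpace

/-- Three dimensional Euclidean space. -/
abbrev E3 : Type := EuclideanSpace ℝ (Fin 3)

/-- The tetrahedra of a simplicial complex, each given by its set of four (affinely independent)
vertices; the corresponding closed element is the convex hull. -/
def tetrahedra (K : Geometry.SimplicialComplex ℝ E3) : Set (Finset E3) :=
  {T | T ∈ K.faces ∧ T.card = 4}

/-- `K` is a (conforming, affine) triangulation of `Ω`: a finite simplicial complex in which every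
face is a face of some tetrahedron, and `Ω` is the open set covered by the closed tetrahedra. -/
structure IsTriangulationOf (K : Geometry.SimplicialComplex ℝ E3) (Ω : Set E3) : Prop where
  finite_faces : K.faces.Finite
  exists_tetrahedron : ∀ s ∈ K.faces, ∃ T ∈ tetrahedra K, s ⊆ T
  eq_interior : Ω = interior (⋃ T ∈ tetrahedra K, convexHull ℝ (T : Set E3))

/-- The maximal mesh size: the largest diameter of a tetrahedron. -/
noncomputable def meshSize (K : Geometry.SimplicialComplex ℝ E3) : ℝ :=
  sSup ((fun T : Finset E3 => Metric.diam (convexHull ℝ (T : Set E3))) '' tetrahedra K)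

/-- `Ω` has a support plane at `z`: for some normal `v ≠ 0` the set `Ω` lies in the half-space
`{x | (z - x) · v ≥ 0}`, whose boundary plane passes through `z`. -/
def HasSupportPlaneAt (Ω : Set E3) (z : E3) : Prop :=
  ∃ v : E3, v ≠ 0 ∧ ∀ x ∈ Ω, 0 ≤ ⟪z - x, v⟫

/-- `Ω` is a polyhedral bounded domain with triangulation `K`, and it is discrete convex: every
vertex of the triangulation on the boundary of `Ω` has a support plane for `Ω`.
(`Ω` is open and bounded, being the interior of a finite union of tetrahedra.) -/
structure IsDiscreteConvexDomain (Ω : Set E3) (K : Geometry.SimplicialComplex ℝ E3) : Prop where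
  isConnected : IsConnected Ω
  triangulation : IsTriangulationOf K Ω
  support : ∀ z ∈ K.vertices ∩ frontier Ω, HasSupportPlaneAt Ω z

/-- A sequence of triangulations is quasi-uniform: for a constant `c > 0` independent of the
triangulation, every tetrahedron contains a ball of radius `c` times the maximal mesh size. -/
def QuasiUniform (K : ℕ → Geometry.SimplicialComplex ℝ E3) : Prop :=
  ∃ c : ℝ, 0 < c ∧ ∀ n, ∀ T ∈ tetrahedra (K n),
    ∃ x : E3, Metric.ball x (c * meshSize (K n)) ⊆ convexHull ℝ (T : Set E3)

/-! Let `D n` be the convex hull of `Ω n`. A boundary point of `Ω n` lies within one mesh size of a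
boundary vertex, and the support plane there keeps that vertex out of the open set `D n`. So the
inner parallel set of `D n` at depth one mesh size misses the boundary of `Ω n`; being convex, hence
connected, it lies inside `Ω n` or is disjoint from it. By Blaschke selection the `D n` converge
along a subsequence to a closed convex `L`. Points off `L` eventually leave `D n`, points of
`interior L` eventually enter the inner sets, and the frontier of `L` is null. If disjointness
recurs infinitely often, the limit along those indices is `∅`; otherwise it is `interior L`.
Dominated convergence gives the `L¹` statement. -/

/-! ### Boundary vertices of a triangulated set -/

/-- A simplex of a complex which meets the relative interior of a face contains that face. -/
theorem Geometry.SimplicialComplex.subset_of_pos_combination_mem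
    {E : Type*} [AddCommGroup E] [Module ℝ E]
    (K : Geometry.SimplicialComplex ℝ E) {s T : Finset E} (hs : s ∈ K.faces) (hT : T ∈ K.faces)
    {w : E → ℝ} (hw : ∀ i ∈ s, 0 < w i) (hw1 : ∑ i ∈ s, w i = 1)
    (hp : ∑ i ∈ s, w i • i ∈ convexHull ℝ (T : Set E)) : s ⊆ T := by
  classical
  have hps : ∑ i ∈ s, w i • i ∈ convexHull ℝ (s : Set E) :=
    Finset.mem_convexHull'.2 ⟨w, fun i hi => (hw i hi).le, hw1, rfl⟩
  have hpi := K.inter_subset_convexHull hs hT ⟨hps, hp⟩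
  rw [← Finset.coe_inter, Finset.mem_convexHull'] at hpi
  obtain ⟨u, -, hu1, hup⟩ := hpi
  have hsum : ∑ i ∈ s, (if i ∈ T then u i else 0) = 1 := by
    rw [← Finset.sum_filter, Finset.filter_mem_eq_inter, hu1]
  have hcomb : ∑ i ∈ s, (if i ∈ T then u i else 0) • i = ∑ i ∈ s, w i • i := by
    simp_rw [ite_smul, zero_smul]
    rw [← Finset.sum_filter, Finset.filter_mem_eq_inter, hup]
  intro i hi
  by_contra hiT
  have h := (K.indep hs).eq_of_sum_eq_sum_subtype (hw1.trans hsum.symm) hcomb.symm i hi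
  rw [if_neg hiT] at h
  exact (hw i hi).ne' h

/-- If a vertex of a face is interior to a finite union of simplices of a complex, then so is every
point in the relative interior of that face. -/
theorem Geometry.SimplicialComplex.mem_interior_biUnion_of_vertex_mem_interior
    {E : Type*} [NormedAddCommGroup E] [NormedSpace ℝ E]
    (K : Geometry.SimplicialComplex ℝ E) {F : Set (Finset E)} (hF : F.Finite) (hFK : F ⊆ K.faces)
    {s : Finset E} (hs : s ∈ K.faces) {w : E → ℝ} (hw : ∀ i ∈ s, 0 < w i)
    (hw1 : ∑ i ∈ s, w i = 1) {z : E} (hz : z ∈ s)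
    (hzi : z ∈ interior (⋃ T ∈ F, convexHull ℝ (T : Set E))) :
    ∑ i ∈ s, w i • i ∈ interior (⋃ T ∈ F, convexHull ℝ (T : Set E)) := by
  classical
  set y := ∑ i ∈ s, w i • i with hy
  -- Move slightly from `z` towards `y`: the point stays interior to the union but has positive
  -- weight on all of `s`, so every simplex of `F` through it contains `s`.
  obtain ⟨δ, hδ0, hδ1, hp⟩ : ∃ δ : ℝ, 0 < δ ∧ δ < 1 ∧
      z + δ • (y - z) ∈ interior (⋃ T ∈ F, convexHull ℝ (T : Set E)) := by
    have hc : Tendsto (fun δ : ℝ => z + δ • (y - z)) (𝓝 0) (𝓝 z) := by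
      have : Continuous fun δ : ℝ => z + δ • (y - z) := by fun_prop
      simpa using this.tendsto 0
    have h1 := (hc.eventually (isOpen_interior.mem_nhds hzi)).filter_mono
      (nhdsWithin_le_nhds (s := Ioi 0))
    obtain ⟨δ, hδ, hδ'⟩ := (h1.and (Ioo_mem_nhdsGT (zero_lt_one' ℝ))).exists
    exact ⟨δ, hδ'.1, hδ'.2, hδ⟩
  set p := z + δ • (y - z) with hpdef
  have hpw : p = ∑ i ∈ s, (δ * w i + if i = z then 1 - δ else 0) • i := by
    simp only [add_smul, Finset.sum_add_distrib, ite_smul, zero_smul, Finset.sum_ite_eq', hz,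
      if_true, mul_smul, ← Finset.smul_sum, hpdef]
    module
  have hsub : ∀ T ∈ F, p ∈ convexHull ℝ (T : Set E) → s ⊆ T := by
    intro T hT hpT
    refine K.subset_of_pos_combination_mem hs (hFK hT)
      (w := fun i => δ * w i + if i = z then 1 - δ else 0) ?_ ?_ (hpw ▸ hpT)
    · intro i hi
      have := mul_pos hδ0 (hw i hi)
      split_ifs <;> linarith
    · simp [Finset.sum_add_distrib, ← Finset.mul_sum, hw1, hz]
  have hnear : ∀ᶠ x in 𝓝 p, ∃ T ∈ F, s ⊆ T ∧ x ∈ convexHull ℝ (T : Set E) := by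
    have h1 : ∀ᶠ x in 𝓝 p, ∀ T ∈ F, p ∉ convexHull ℝ (T : Set E) →
        x ∉ convexHull ℝ (T : Set E) := by
      refine (eventually_all_finite hF).2 fun T _ => ?_
      by_cases hpT : p ∈ convexHull ℝ (T : Set E)
      · exact Eventually.of_forall fun x hx => absurd hpT hx
      · filter_upwards [(T.finite_toSet.isClosed_convexHull ℝ).isOpen_compl.mem_nhds hpT]
          with x hx _ using hx
    filter_upwards [h1, mem_interior_iff_mem_nhds.1 hp] with x hx hxU
    obtain ⟨T, hT, hxT⟩ := mem_iUnion₂.1 hxU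
    have hpT : p ∈ convexHull ℝ (T : Set E) := by
      by_contra h
      exact hx T hT h hxT
    exact ⟨T, hT, hsub T hT hpT, hxT⟩
  have hη := hw z hz
  set η := w z with hηdef
  have hden : 0 < η + (1 - δ) := by linarith
  -- Chosen so that `y` divides the segment from `q` to `p`, where `q` lies on the ray from `z`
  -- beyond `y`, still in the hull of `s`. The homothety centred at `q` with ratio `ε` carries a
  -- neighbourhood of `p` to one of `y`, inside the same simplices.
  set ε := η / (η + (1 - δ)) with hε
  have hε0 : 0 < ε := div_pos hη hden
  have hε1 : ε ≤ 1 := (div_le_one hden).2 (by linarith)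
  have hεη : (1 - ε) * η = ε * (1 - δ) := by
    rw [hε]; field_simp; ring
  have hq : (1 + η) • y - η • z ∈ convexHull ℝ (s : Set E) := by
    refine Finset.mem_convexHull'.2 ⟨fun i => (1 + η) * w i - if i = z then η else 0, ?_, ?_, ?_⟩
    · intro i hi
      dsimp only
      split_ifs with h
      · subst h; rw [← hηdef]; nlinarith
      · have := hw i hi
        have := mul_pos (show 0 < 1 + η by linarith) this
        linarith
    · simp [Finset.sum_sub_distrib, ← Finset.mul_sum, hw1, hz]
    · simp only [sub_smul, Finset.sum_sub_distrib, ite_smul, zero_smul, Finset.sum_ite_eq', hz,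
        if_true, mul_smul, ← Finset.smul_sum, ← hy]
  set q := (1 + η) • y - η • z with hqdef
  have hyq : y = (1 - ε) • q + ε • p := by
    have : (1 - ε) • q + ε • p = y + ((1 - ε) * η - ε * (1 - δ)) • (y - z) := by
      rw [hqdef, hpdef]; module
    rw [this, hεη, sub_self, zero_smul, add_zero]
  rw [mem_interior_iff_mem_nhds]
  have hc : Tendsto (fun u : E => p + ε⁻¹ • (u - y)) (𝓝 y) (𝓝 p) := by
    have : Continuous fun u : E => p + ε⁻¹ • (u - y) := by fun_prop
    simpa using this.tendsto y
  filter_upwards [hc.eventually hnear] with u hu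
  obtain ⟨T, hT, hsT, huT⟩ := hu
  refine mem_iUnion₂.2 ⟨T, hT, ?_⟩
  have := (convex_convexHull ℝ (T : Set E)) (convexHull_mono (Finset.coe_subset.2 hsT) hq) huT
    (sub_nonneg.2 hε1) hε0.le (by ring)
  convert this using 1
  rw [smul_add, smul_smul, mul_inv_cancel₀ hε0.ne', one_smul, ← add_assoc, ← hyq]
  abel

/-- Four affinely independent points span the space, so their hull has interior. This places the
vertices of tetrahedra in the closure of the triangulated set. -/
theorem convexHull_subset_closure_interior_of_mem_tetrahedra
    {K : Geometry.SimplicialComplex ℝ E3} {T : Finset E3} (hT : T ∈ tetrahedra K) :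
    convexHull ℝ (T : Set E3) ⊆ closure (interior (convexHull ℝ (T : Set E3))) := by
  have hspan : affineSpan ℝ (T : Set E3) = ⊤ := by
    have := (K.indep hT.1).affineSpan_eq_top_iff_card_eq_finrank_add_one.2 (by simp [hT.2])
    simpa using this
  rw [(convex_convexHull ℝ (T : Set E3)).closure_interior_eq_closure_of_nonempty_interior
    (interior_convexHull_nonempty_iff_affineSpan_eq_top.2 hspan)]
  exact subset_closure

theorem IsTriangulationOf.finite_tetrahedra {K : Geometry.SimplicialComplex ℝ E3} {Ω : Set E3}
    (h : IsTriangulationOf K Ω) : (tetrahedra K).Finite :=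
  h.finite_faces.subset fun _ hT => hT.1

theorem IsTriangulationOf.isOpen {K : Geometry.SimplicialComplex ℝ E3} {Ω : Set E3}
    (h : IsTriangulationOf K Ω) : IsOpen Ω :=
  h.eq_interior ▸ isOpen_interior

theorem IsTriangulationOf.dist_le_meshSize {K : Geometry.SimplicialComplex ℝ E3} {Ω : Set E3}
    (h : IsTriangulationOf K Ω) {T : Finset E3} (hT : T ∈ tetrahedra K) {x y : E3}
    (hx : x ∈ convexHull ℝ (T : Set E3)) (hy : y ∈ convexHull ℝ (T : Set E3)) :
    dist x y ≤ meshSize K :=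
  (Metric.dist_le_diam_of_mem
    (isBounded_convexHull.2 T.finite_toSet.isBounded) hx hy).trans
    (le_csSup (h.finite_tetrahedra.image _).bddAbove (mem_image_of_mem _ hT))

/-- Every boundary point of a triangulated set has a boundary vertex within one mesh size. -/
theorem IsTriangulationOf.exists_vertex_mem_frontier {K : Geometry.SimplicialComplex ℝ E3}
    {Ω : Set E3} (h : IsTriangulationOf K Ω) {y : E3} (hy : y ∈ frontier Ω) :
    ∃ z ∈ K.vertices ∩ frontier Ω, dist z y ≤ meshSize K := by
  classical
  set U := ⋃ T ∈ tetrahedra K, convexHull ℝ (T : Set E3) with hU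
  have hUc : IsClosed U :=
    h.finite_tetrahedra.isClosed_biUnion fun T _ => T.finite_toSet.isClosed_convexHull ℝ
  have hΩU : Ω ⊆ U := h.eq_interior ▸ interior_subset
  have hyU : y ∈ U := closure_minimal hΩU hUc (frontier_subset_closure hy)
  obtain ⟨T, hT, hyT⟩ := mem_iUnion₂.1 hyU
  obtain ⟨w, hw0, hw1, hwy⟩ := Finset.mem_convexHull'.1 hyT
  -- The face whose relative interior contains `y`; if one of its vertices were in `Ω`, so would `y`
  -- be.
  set s := T.filter fun i => 0 < w i with hs
  have hzero : ∀ i ∈ T, i ∉ s → w i = 0 := fun i hi his =>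
    le_antisymm (not_lt.1 fun h0 => his (Finset.mem_filter.2 ⟨hi, h0⟩)) (hw0 i hi)
  have hs1 : ∑ i ∈ s, w i = 1 := by
    rw [← hw1]; exact Finset.sum_subset (Finset.filter_subset _ _) hzero
  have hsy : ∑ i ∈ s, w i • i = y := by
    rw [← hwy]
    exact Finset.sum_subset (Finset.filter_subset _ _) fun i hi his => by
      rw [hzero i hi his, zero_smul]
  obtain ⟨z, hz⟩ : s.Nonempty := Finset.nonempty_of_sum_ne_zero (hs1 ▸ one_ne_zero)
  have hsK : s ∈ K.faces := K.down_closed hT.1 (Finset.filter_subset _ _) ⟨z, hz⟩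
  have hzT : z ∈ convexHull ℝ (T : Set E3) := subset_convexHull ℝ _ (Finset.mem_filter.1 hz).1
  refine ⟨z, ⟨K.down_closed hsK (by simpa using hz) (by simp), ?_⟩,
    h.dist_le_meshSize hT hzT hyT⟩
  refine ⟨?_, ?_⟩
  · have := convexHull_subset_closure_interior_of_mem_tetrahedra hT hzT
    rw [h.eq_interior]
    exact closure_mono (interior_mono (subset_biUnion_of_mem (u := fun T : Finset E3 =>
      convexHull ℝ (T : Set E3)) hT)) this
  · rw [h.isOpen.interior_eq]
    intro hzΩ
    have hyΩ : y ∈ Ω := by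
      rw [h.eq_interior] at hzΩ ⊢
      rw [← hsy]
      exact K.mem_interior_biUnion_of_vertex_mem_interior h.finite_tetrahedra (fun _ hT => hT.1)
        hsK (fun i hi => (Finset.mem_filter.1 hi).2) hs1 hz hzΩ
    exact hy.2 (by rwa [h.isOpen.interior_eq])

/-! ### The dichotomy for discrete convex domains -/

/-- The closed half-space also contains the hull, which is open; a small step from `z` along `v`
would leave the half-space while staying in the hull. -/
theorem HasSupportPlaneAt.notMem_convexHull {Ω : Set E3} (hΩ : IsOpen Ω) {z : E3}
    (hz : HasSupportPlaneAt Ω z) : z ∉ convexHull ℝ Ω := by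
  obtain ⟨v, hv, hvΩ⟩ := hz
  intro hzD
  have hhalf : convexHull ℝ Ω ⊆ {x | ⟪v, x⟫ ≤ ⟪v, z⟫} := by
    refine convexHull_min (fun x hx => ?_)
      (convex_halfSpace_le (innerSL ℝ v).toLinearMap.isLinear _)
    have := hvΩ x hx
    rw [real_inner_comm, inner_sub_right] at this
    exact sub_nonneg.1 this
  have hc : Tendsto (fun t : ℝ => z + t • v) (𝓝 0) (𝓝 z) := by
    have : Continuous fun t : ℝ => z + t • v := by fun_prop
    simpa using this.tendsto 0
  have h1 := (hc.eventually (hΩ.convexHull.mem_nhds hzD)).filter_mono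
    (nhdsWithin_le_nhds (s := Ioi 0))
  obtain ⟨t, ht, ht0⟩ := (h1.and self_mem_nhdsWithin).exists
  have h2 : ⟪v, z + t • v⟫ ≤ ⟪v, z⟫ := hhalf ht
  rw [inner_add_right, inner_smul_right] at h2
  have := mul_pos (mem_Ioi.1 ht0) (real_inner_self_pos.2 hv)
  linarith

theorem Convex.setOf_closedBall_subset {E : Type*} [SeminormedAddCommGroup E] [NormedSpace ℝ E]
    {D : Set E} (hD : Convex ℝ D) (r : ℝ) : Convex ℝ {x | Metric.closedBall x r ⊆ D} := by
  intro x hx y hy a b ha hb hab p hp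
  set d := p - (a • x + b • y) with hd
  have hdr : ‖d‖ ≤ r := by rwa [Metric.mem_closedBall, dist_eq_norm] at hp
  have hxd : x + d ∈ D := hx (by simpa [Metric.mem_closedBall, dist_eq_norm] using hdr)
  have hyd : y + d ∈ D := hy (by simpa [Metric.mem_closedBall, dist_eq_norm] using hdr)
  have hp' : p = a • (x + d) + b • (y + d) := by
    rw [smul_add, smul_add, add_add_add_comm, ← add_smul, hab, one_smul, hd]
    abel
  rw [hp']
  exact hD hxd hyd ha hb hab

/-- The set of points whose ball of radius one mesh size lies in the convex hull of a discrete
convex domain is either contained in the domain or disjoint from it. -/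
theorem IsDiscreteConvexDomain.subset_or_disjoint {Ω : Set E3}
    {K : Geometry.SimplicialComplex ℝ E3} (h : IsDiscreteConvexDomain Ω K) :
    {x | Metric.closedBall x (meshSize K) ⊆ convexHull ℝ Ω} ⊆ Ω ∨
      Disjoint {x | Metric.closedBall x (meshSize K) ⊆ convexHull ℝ Ω} Ω := by
  have hopen := h.triangulation.isOpen
  set I := {x | Metric.closedBall x (meshSize K) ⊆ convexHull ℝ Ω} with hI
  have hconv : Convex ℝ I := (convex_convexHull ℝ Ω).setOf_closedBall_subset _
  have hfr : ∀ x ∈ I, x ∉ frontier Ω := by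
    intro x hx hxf
    obtain ⟨z, hz, hzx⟩ := h.triangulation.exists_vertex_mem_frontier hxf
    exact (h.support z hz).notMem_convexHull hopen (hx hzx)
  rcases (I ∩ Ω).eq_empty_or_nonempty with he | hne
  · exact Or.inr (disjoint_iff_inter_eq_empty.2 he)
  · refine Or.inl (hconv.isPreconnected.subset_of_closure_inter_subset hopen hne ?_)
    rintro x ⟨hxc, hxI⟩
    by_contra hxΩ
    exact hfr x hxI ⟨hxc, by rwa [hopen.interior_eq]⟩

/-! ### Blaschke selection -/

/-- If a closed ball is contained in a set at Hausdorff distance less than half its radius from an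
open convex set, then the concentric ball of half the radius is contained in the convex set. -/
theorem Convex.closedBall_subset_of_forall_exists_dist_lt {E : Type*} [NormedAddCommGroup E]
    [InnerProductSpace ℝ E] [CompleteSpace E] {D : Set E} (hD : Convex ℝ D) (hDo : IsOpen D)
    {x : E} {r : ℝ} (hr : 0 ≤ r)
    (h : ∀ y ∈ Metric.closedBall x (2 * r), ∃ a ∈ closure D, dist y a < r) :
    Metric.closedBall x r ⊆ D := by
  intro y hy
  by_contra hyD
  obtain ⟨f, hf⟩ := geometric_hahn_banach_open_point hD hDo hyD
  set v := (InnerProductSpace.toDual ℝ E).symm f with hv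
  have hfv : ∀ a, f a = ⟪v, a⟫ := fun a => by simp [hv]
  have hcl : ∀ a ∈ closure D, ⟪v, a⟫ ≤ ⟪v, y⟫ := by
    intro a ha
    have hc : IsClosed {a : E | ⟪v, a⟫ ≤ ⟪v, y⟫} :=
      isClosed_le (by fun_prop) continuous_const
    refine closure_minimal (fun b hb => ?_) hc ha
    have := (hf b hb).le
    rwa [hfv, hfv] at this
  have hv0 : v ≠ 0 := by
    rintro h0
    obtain ⟨a, ha, -⟩ := h x (Metric.mem_closedBall_self (by positivity))
    obtain ⟨b, hb⟩ := closure_nonempty_iff.1 ⟨a, ha⟩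
    have := hf b hb
    simp [hfv, h0] at this
  have hvn : 0 < ‖v‖ := norm_pos_iff.2 hv0
  have hn : ‖(r / ‖v‖) • v‖ = r := by
    rw [norm_smul, Real.norm_of_nonneg (by positivity), div_mul_cancel₀ _ hvn.ne']
  -- Pushing `y` a distance `r` along the separating normal stays within `2 * r` of `x`, but ends at
  -- distance at least `r` from `closure D`.
  obtain ⟨a, ha, hya⟩ := h (y + (r / ‖v‖) • v) (by
    rw [Metric.mem_closedBall, dist_eq_norm] at hy ⊢
    calc ‖y + (r / ‖v‖) • v - x‖ = ‖(y - x) + (r / ‖v‖) • v‖ := by congr 1; abel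
      _ ≤ ‖y - x‖ + ‖(r / ‖v‖) • v‖ := norm_add_le _ _
      _ ≤ 2 * r := by rw [hn]; linarith)
  have h1 : ⟪v, y + (r / ‖v‖) • v - a⟫ ≤ ‖v‖ * ‖y + (r / ‖v‖) • v - a‖ :=
    real_inner_le_norm _ _
  have h2 : ⟪v, y + (r / ‖v‖) • v - a⟫ = (⟪v, y⟫ - ⟪v, a⟫) + r * ‖v‖ := by
    rw [inner_sub_right, inner_add_right, inner_smul_right, real_inner_self_eq_norm_sq]
    field_simp
    ring
  rw [dist_eq_norm] at hya
  have := hcl a ha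
  nlinarith

/-- Blaschke selection for open convex sets in a compact set: along a subsequence they exhaust the
interior of a closed convex set and avoid each point of its complement. -/
theorem exists_subseq_convex_limit {E : Type*} [NormedAddCommGroup E]
    [InnerProductSpace ℝ E] [CompleteSpace E] {B : Set E} (hB : IsCompact B) {D : ℕ → Set E}
    (hDo : ∀ n, IsOpen (D n)) (hDc : ∀ n, Convex ℝ (D n)) (hDn : ∀ n, (D n).Nonempty)
    (hDB : ∀ n, D n ⊆ B) :
    ∃ (L : Set E) (φ : ℕ → ℕ), StrictMono φ ∧ IsClosed L ∧ Convex ℝ L ∧ L ⊆ B ∧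
      (∀ x ∉ L, ∀ᶠ k in atTop, x ∉ D (φ k)) ∧
      ∀ x ∈ interior L, ∃ r > 0, ∀ᶠ k in atTop, Metric.closedBall x r ⊆ D (φ k) := by
  have hclB : ∀ n, closure (D n) ⊆ B := fun n => closure_minimal (hDB n) hB.isClosed
  let C : ℕ → TopologicalSpace.NonemptyCompacts E := fun n =>
    ⟨⟨closure (D n), hB.of_isClosed_subset isClosed_closure (hclB n)⟩, (hDn n).closure⟩
  have hC : ∀ n, (C n : Set E) = closure (D n) := fun _ => rfl
  obtain ⟨L, hLB, φ, hφ, hlim⟩ :=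
    (TopologicalSpace.NonemptyCompacts.isCompact_subsets_of_isCompact hB).tendsto_subseq
      (x := C) hclB
  have hev : ∀ ε > 0, ∀ᶠ k in atTop, Metric.hausdorffDist (closure (D (φ k))) (L : Set E) < ε :=
    fun ε hε => (Metric.tendsto_nhds.1 hlim) ε hε
  have hfin : ∀ n, Metric.hausdorffEDist (closure (D n)) (L : Set E) ≠ ⊤ := fun n =>
    Metric.hausdorffEDist_ne_top_of_nonempty_of_bounded (C n).nonempty L.nonempty
      (C n).isCompact.isBounded L.isCompact.isBounded
  have hLc : IsClosed (L : Set E) := L.isCompact.isClosed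
  refine ⟨L, φ, hφ, hLc, ?_, hLB, ?_, ?_⟩
  · intro x hx y hy a b ha hb hab
    rw [← hLc.closure_eq, Metric.mem_closure_iff]
    intro ε hε
    obtain ⟨k, hk⟩ := (hev (ε / 2) (by positivity)).exists
    obtain ⟨x', hx', hxx'⟩ := Metric.exists_dist_lt_of_hausdorffDist_lt' hx hk (hfin _)
    obtain ⟨y', hy', hyy'⟩ := Metric.exists_dist_lt_of_hausdorffDist_lt' hy hk (hfin _)
    obtain ⟨c, hc, hcd⟩ := Metric.exists_dist_lt_of_hausdorffDist_lt
      ((hDc (φ k)).closure hx' hy' ha hb hab) hk (hfin _)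
    refine ⟨c, hc, ?_⟩
    have h1 : dist (a • x + b • y) (a • x' + b • y') ≤ ε / 2 := by
      rw [dist_comm]
      calc dist (a • x' + b • y') (a • x + b • y)
          ≤ dist (a • x') (a • x) + dist (b • y') (b • y) := dist_add_add_le _ _ _ _
        _ = a * dist x' x + b * dist y' y := by
          rw [dist_smul₀, dist_smul₀, Real.norm_of_nonneg ha, Real.norm_of_nonneg hb]
        _ ≤ a * (ε / 2) + b * (ε / 2) := by gcongr
        _ = ε / 2 := by rw [← add_mul, hab, one_mul]
    linarith [dist_triangle (a • x + b • y) (a • x' + b • y') c]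
  · intro x hx
    obtain ⟨ε, hε, hball⟩ := Metric.isOpen_iff.1 hLc.isOpen_compl x hx
    filter_upwards [hev ε hε] with k hk hxD
    obtain ⟨y, hy, hxy⟩ := Metric.exists_dist_lt_of_hausdorffDist_lt (subset_closure hxD) hk
      (hfin _)
    exact hball (Metric.mem_ball'.2 hxy) hy
  · intro x hx
    obtain ⟨ε, hε, hball⟩ := Metric.nhds_basis_closedBall.mem_iff.1 (mem_interior_iff_mem_nhds.1 hx)
    refine ⟨ε / 2, by positivity, ?_⟩
    filter_upwards [hev (ε / 2) (by positivity)] with k hk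
    refine (hDc (φ k)).closedBall_subset_of_forall_exists_dist_lt (hDo _) (by positivity) ?_
    intro y hy
    rw [mul_div_cancel₀ _ (two_ne_zero' ℝ)] at hy
    obtain ⟨a, ha, hya⟩ := Metric.exists_dist_lt_of_hausdorffDist_lt' (hball hy) hk (hfin _)
    exact ⟨a, ha, by rwa [dist_comm]⟩

/-! ### Convergence in `L¹` and conclusion -/

/-- Indicators which are almost everywhere eventually constant converge in `L¹` on sets of finite
measure. -/
theorem tendsto_eLpNorm_indicator_sub_of_ae_eventually {α : Type*} [MeasurableSpace α]
    {μ : Measure α} [IsFiniteMeasure μ] {A : ℕ → Set α} {S : Set α}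
    (hA : ∀ n, MeasurableSet (A n)) (hS : MeasurableSet S)
    (h : ∀ᵐ x ∂μ, ∀ᶠ k in atTop, (x ∈ A k ↔ x ∈ S)) :
    Tendsto (fun k => eLpNorm
      (fun x => (A k).indicator (fun _ => (1 : ℝ)) x - S.indicator (fun _ => (1 : ℝ)) x) 1 μ)
      atTop (𝓝 0) := by
  classical
  simp_rw [eLpNorm_one_eq_lintegral_enorm]
  rw [← lintegral_zero (μ := μ)]
  refine tendsto_lintegral_of_dominated_convergence (fun _ => 1) (fun n => ?_) (fun n => ?_)
    (by simp) ?_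
  · exact ((measurable_const.indicator (hA n)).sub (measurable_const.indicator hS)).enorm
  · refine Eventually.of_forall fun x => ?_
    by_cases h1 : x ∈ A n <;> by_cases h2 : x ∈ S <;> simp [h1, h2]
  · filter_upwards [h] with x hx
    refine tendsto_const_nhds.congr' ?_
    filter_upwards [hx] with k hk
    by_cases h2 : x ∈ S <;> simp [hk, h2]

theorem mainTheorem1
    (Q : Set E3) (hQ_convex : Convex ℝ Q) (hQ_bounded : Bornology.IsBounded Q) (hQ_open : IsOpen Q)
    (Ω : ℕ → Set E3) (K : ℕ → Geometry.SimplicialComplex ℝ E3)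
    (hΩ : ∀ n, IsDiscreteConvexDomain (Ω n) (K n))
    (hK : QuasiUniform K)
    (hmesh : Tendsto (fun n => meshSize (K n)) atTop (𝓝 0))
    (hΩQ : ∀ n, Ω n ⊆ Q) :
    ∃ (Ω₀ : Set E3) (φ : ℕ → ℕ),
      IsOpen Ω₀ ∧ Convex ℝ Ω₀ ∧ Ω₀ ⊆ Q ∧ StrictMono φ ∧
      Tendsto
        (fun k => eLpNorm
          (fun x => (Ω (φ k)).indicator (fun _ => (1 : ℝ)) x - Ω₀.indicator (fun _ => (1 : ℝ)) x)
          1 (volume.restrict Q))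
        atTop (𝓝 0) := by
  have hopen : ∀ n, IsOpen (Ω n) := fun n => (hΩ n).triangulation.isOpen
  have hne : ∀ n, (Ω n).Nonempty := fun n => (hΩ n).isConnected.nonempty
  have hQfin : IsFiniteMeasure (volume.restrict Q) :=
    isFiniteMeasure_restrict.2 hQ_bounded.measure_lt_top.ne
  obtain ⟨L, ψ, hψ, hLc, hLconv, hLQ, hout, hin⟩ := exists_subseq_convex_limit
    hQ_bounded.isCompact_closure (D := fun n => convexHull ℝ (Ω n))
    (fun n => (hopen n).convexHull) (fun n => convex_convexHull ℝ _)
    (fun n => (hne n).convexHull)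
    (fun n => (convexHull_min (hΩQ n) hQ_convex).trans subset_closure)
  -- The limit is only known to lie in `closure Q`, but an open convex set is the interior of its
  -- closure.
  have hLQ' : interior L ⊆ Q := by
    rw [← hQ_open.interior_eq, ← hQ_convex.interior_closure_eq_interior_of_nonempty_interior
      (by rw [hQ_open.interior_eq]; exact (hne 0).mono (hΩQ 0))]
    exact interior_mono hLQ
  have hae : ∀ᵐ x ∂(volume.restrict Q), x ∈ interior L ∨ x ∉ L := by
    refine ae_restrict_of_ae ?_
    filter_upwards [measure_eq_zero_iff_ae_notMem.1 (hLconv.addHaar_frontier volume)] with x hx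
    rw [hLc.frontier_eq, Set.mem_sdiff] at hx
    tauto
  have hout' : ∀ x ∉ L, ∀ᶠ k in atTop, x ∉ Ω (ψ k) := fun x hx =>
    (hout x hx).mono fun k hk hxk => hk (subset_convexHull ℝ _ hxk)
  have hin' : ∀ x ∈ interior L, ∀ᶠ k in atTop,
      Metric.closedBall x (meshSize (K (ψ k))) ⊆ convexHull ℝ (Ω (ψ k)) := by
    intro x hx
    obtain ⟨r, hr, hball⟩ := hin x hx
    filter_upwards [hball, (hmesh.comp hψ.tendsto_atTop).eventually (gt_mem_nhds hr)] with k hk hm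
    exact (Metric.closedBall_subset_closedBall (le_of_lt hm)).trans hk
  by_cases hfreq : ∃ᶠ k in atTop,
      Disjoint {x | Metric.closedBall x (meshSize (K (ψ k))) ⊆ convexHull ℝ (Ω (ψ k))} (Ω (ψ k))
  · obtain ⟨θ, hθ, hdisj⟩ := extraction_of_frequently_atTop hfreq
    refine ⟨∅, ψ ∘ θ, isOpen_empty, convex_empty, empty_subset _, hψ.comp hθ,
      tendsto_eLpNorm_indicator_sub_of_ae_eventually (fun n => (hopen _).measurableSet)
        MeasurableSet.empty ?_⟩
    filter_upwards [hae] with x hx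
    rcases hx with hx | hx
    · filter_upwards [hθ.tendsto_atTop.eventually (hin' x hx)] with k hk
      exact iff_of_false (fun h => disjoint_left.1 (hdisj k) hk h) (notMem_empty x)
    · filter_upwards [hθ.tendsto_atTop.eventually (hout' x hx)] with k hk
      exact iff_of_false hk (notMem_empty x)
  · refine ⟨interior L, ψ, isOpen_interior, hLconv.interior, hLQ', hψ,
      tendsto_eLpNorm_indicator_sub_of_ae_eventually (fun n => (hopen _).measurableSet)
        isOpen_interior.measurableSet ?_⟩
    filter_upwards [hae] with x hx
    rcases hx with hx | hx
    · filter_upwards [hin' x hx, not_frequently.1 hfreq] with k hk hk'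
      exact iff_of_true (((hΩ (ψ k)).subset_or_disjoint.resolve_right hk') hk) hx
    · filter_upwards [hout' x hx] with k hk
      exact iff_of_false hk fun h => hx (interior_subset h)
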